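/- Lemma (time interval between link breaks). Consider the social Hegselmann–Krause dynamics of $n$ agents with an undirected simple physical connectivity graph $G_{ph}$ on $[n]$, confidence bound $R>0$ and initial state $x[0]\in\mathbb R^n$: the influence graph $\tilde G[k]$ has vertex set $[n]$ and an edge between distinct $i,j$ iff $i,j$ are adjacent in $G_{ph}$ and $|x_i[k]-x_j[k]|\le R$; the neighbour set $\mathcal N_i[k]$ consists of $i$ and the agents adjacent to $i$ in $\tilde G[k]$; and $x_i[k+1]=\frac{1}{|\mathcal N_i[k]|}\sum_{j\in\mathcal N_i[k]}x_j[k]$. A link break (respectively, the formation of a new edge) between $i$ and $j$ occurs at time $k\ge 1$ if $i,j$ are adjacent in $\tilde G[k-1]$ but not in $\tilde G[k]$ (respectively, not adjacent in $\tilde G[k-1]$ but adjacent in $\tilde G[k]$). There is an absolute constant $C>0$, independent of $n$, $G_{ph}$, $R$, $x[0]$, $k_0$, $k_1$ and the component, such that the following holds. Let $G_P=(V_P,E_P)$ be a connected component of $\tilde G[k_0]$ for some time $k_0\ge 0$, and let $k_1>k_0$. Suppose that (i) no link break between two agents of $V_P$ occurs at any time $k$ with $k_0<k<k_1$, (ii)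 at least one link break between two agents of $V_P$ occurs at time $k_1$, and (iii) no new edge between a node in $V_P$ and another node in $[n]$ is formed at any time $k$ with $k_0<k<k_1$. Then $k_1-k_0\le C\,n^3\log n$; that is, $k_1-k_0=O(n^3\log n)$. -/

import Mathlib

namespace SocialHK

/-- The influence graph of the state `x`: two distinct agents are linked iff they are adjacent in the
physical connectivity graph `G` and their opinions differ by at most the confidence bound `R`. -/
def influenceGraph {n : ℕ} (G : SimpleGraph (Fin n)) (R : ℝ) (x : Fin n → ℝ) :
    SimpleGraph (Fin n) where
  Adj i j := G.Adj i j ∧ |x i - x j| ≤ R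
  symm := ⟨fun i j h => ⟨h.1.symm, by rw [abs_sub_comm]; exact h.2⟩⟩
  loopless := ⟨fun i h => G.loopless.irrefl i h.1⟩

open Classical in
/-- The neighbours of agent `i` in the state `x`; an agent is always a neighbour of itself. -/
noncomputable def neighbors {n : ℕ} (G : SimpleGraph (Fin n)) (R : ℝ) (x : Fin n → ℝ)
    (i : Fin n) : Finset (Fin n) :=
  Finset.univ.filter fun j => j = i ∨ (influenceGraph G R x).Adj i j

/-- One step of the dynamics: every agent moves to the average opinion of its neighbours. -/
noncomputable def step {n : ℕ} (G : SimpleGraph (Fin n)) (R : ℝ) (x : Fin n → ℝ) : Fin n → ℝ :=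
  fun i => (∑ j ∈ neighbors G R x i, x j) / ((neighbors G R x i).card : ℝ)

/-- The state `x[k]` at time `k` of the social Hegselmann-Krause system with initial state `x0`. -/
noncomputable def state {n : ℕ} (G : SimpleGraph (Fin n)) (R : ℝ) (x0 : Fin n → ℝ) :
    ℕ → Fin n → ℝ
  | 0 => x0
  | k + 1 => step G R (state G R x0 k)

/-- The influence graph at time `k`. -/
noncomputable def influenceGraphAt {n : ℕ} (G : SimpleGraph (Fin n)) (R : ℝ) (x0 : Fin n → ℝ)
    (k : ℕ) : SimpleGraph (Fin n) :=
  influenceGraph G R (state G R x0 k)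

/-- The link between `i` and `j` breaks at time `k ≥ 1`: it is present at time `k - 1` and absent
at time `k`. -/
def LinkBreak {n : ℕ} (G : SimpleGraph (Fin n)) (R : ℝ) (x0 : Fin n → ℝ) (k : ℕ)
    (i j : Fin n) : Prop :=
  1 ≤ k ∧ (influenceGraphAt G R x0 (k - 1)).Adj i j ∧ ¬ (influenceGraphAt G R x0 k).Adj i j

/-- A new edge between `i` and `j` is formed at time `k ≥ 1`: it is absent at time `k - 1` and
present at time `k`. -/
def LinkFormation {n : ℕ} (G : SimpleGraph (Fin n)) (R : ℝ) (x0 : Fin n → ℝ) (k : ℕ)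
    (i j : Fin n) : Prop :=
  1 ≤ k ∧ ¬ (influenceGraphAt G R x0 (k - 1)).Adj i j ∧ (influenceGraphAt G R x0 k).Adj i j

end SocialHK

/-! While no link of the component changes, its opinions evolve under one fixed averaging operator,
self-adjoint for the weights |N_i|. On vectors of weighted mean zero its quadratic form is at most 1
- 1/(2n³) from above by a Poincaré inequality along paths, and stays away from -1 because of
self-loops. Hence `energy_average_le_of_oscillation`: each step contracts the centred energy by (1 -
1/(2n³))². Links of length at most R bound the initial energy by n⁶R², while a break needs a
difference above R; comparing the two bounds the time. -/

namespace SocialHK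

open Finset

/-! ### Weighted forms of a symmetric neighbourhood structure -/

section Averaging

variable {V : Type*} {S : Finset V} {N : V → Finset V}

/-- The average of `x` over the neighbourhood `N i`. -/
noncomputable def average (N : V → Finset V) (x : V → ℝ) (i : V) : ℝ :=
  (∑ j ∈ N i, x j) / ((N i).card : ℝ)

/-- The squared norm of `x` on `S`, weighted by the sizes of the neighbourhoods. -/
noncomputable def energy (S : Finset V) (N : V → Finset V) (x : V → ℝ) : ℝ :=
  ∑ i ∈ S, ((N i).card : ℝ) * x i ^ 2

/-- The bilinear form of the averaging operator for the weighted inner product on `S`. -/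
noncomputable def pairing (S : Finset V) (N : V → Finset V) (x y : V → ℝ) : ℝ :=
  ∑ i ∈ S, ∑ j ∈ N i, x j * y i

/-- The Dirichlet form: every link is counted in both directions. -/
noncomputable def dirichlet (S : Finset V) (N : V → Finset V) (x : V → ℝ) : ℝ :=
  ∑ i ∈ S, ∑ j ∈ N i, (x i - x j) ^ 2

/-- `N` is a symmetric and reflexive neighbourhood assignment that does not lead out of `S`. -/
structure IsNeighborhood (S : Finset V) (N : V → Finset V) : Prop where
  refl : ∀ i ∈ S, i ∈ N i
  symm : ∀ i ∈ S, ∀ j ∈ S, j ∈ N i → i ∈ N j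
  closed : ∀ i ∈ S, N i ⊆ S

namespace IsNeighborhood

lemma card_pos (h : IsNeighborhood S N) {i : V} (hi : i ∈ S) : (0 : ℝ) < (N i).card := by
  exact_mod_cast Finset.card_pos.2 ⟨i, h.refl i hi⟩

lemma one_le_card (h : IsNeighborhood S N) {i : V} (hi : i ∈ S) : (1 : ℝ) ≤ (N i).card := by
  exact_mod_cast Finset.card_pos.2 ⟨i, h.refl i hi⟩

lemma sum_swap (h : IsNeighborhood S N) (f : V → V → ℝ) :
    ∑ i ∈ S, ∑ j ∈ N i, f i j = ∑ i ∈ S, ∑ j ∈ N i, f j i := by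
  refine Finset.sum_comm' fun i j => ⟨fun ⟨hi, hj⟩ => ?_, fun ⟨hi, hj⟩ => ?_⟩
  · have hjS := h.closed i hi hj
    exact ⟨h.symm i hi j hjS hj, hjS⟩
  · have hiS := h.closed j hj hi
    exact ⟨hiS, h.symm j hj i hiS hi⟩

lemma card_mul_average (h : IsNeighborhood S N) (x : V → ℝ) {i : V} (hi : i ∈ S) :
    ((N i).card : ℝ) * average N x i = ∑ j ∈ N i, x j :=
  mul_div_cancel₀ _ (h.card_pos hi).ne'

/-- Conservation of the weighted mean; it keeps the mean-zero condition along the iteration. -/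
lemma sum_card_mul_average (h : IsNeighborhood S N) (x : V → ℝ) :
    ∑ i ∈ S, ((N i).card : ℝ) * average N x i = ∑ i ∈ S, ((N i).card : ℝ) * x i := by
  rw [Finset.sum_congr rfl fun i hi => h.card_mul_average x hi, h.sum_swap fun _ j => x j]
  simp

lemma energy_eq (S : Finset V) (N : V → Finset V) (x : V → ℝ) :
    energy S N x = ∑ i ∈ S, ∑ _j ∈ N i, x i ^ 2 := by
  simp [energy]

lemma energy_nonneg (S : Finset V) (N : V → Finset V) (x : V → ℝ) : 0 ≤ energy S N x :=
  Finset.sum_nonneg fun _ _ => by positivity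

lemma energy_add_pairing (h : IsNeighborhood S N) (x : V → ℝ) :
    2 * (energy S N x + pairing S N x x) = ∑ i ∈ S, ∑ j ∈ N i, (x i + x j) ^ 2 := by
  have e := h.sum_swap fun i _ => x i ^ 2
  have e' := energy_eq S N x
  have : ∑ i ∈ S, ∑ j ∈ N i, (x i + x j) ^ 2 = ∑ i ∈ S, ∑ j ∈ N i, x i ^ 2 +
      ∑ i ∈ S, ∑ j ∈ N i, x j ^ 2 + 2 * pairing S N x x := by
    simp only [pairing, Finset.mul_sum, ← Finset.sum_add_distrib]
    exact Finset.sum_congr rfl fun i _ => Finset.sum_congr rfl fun j _ => by ring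
  linarith

lemma energy_sub_pairing (h : IsNeighborhood S N) (x : V → ℝ) :
    2 * (energy S N x - pairing S N x x) = dirichlet S N x := by
  have e := h.sum_swap fun i _ => x i ^ 2
  have e' := energy_eq S N x
  have : dirichlet S N x = ∑ i ∈ S, ∑ j ∈ N i, x i ^ 2 +
      ∑ i ∈ S, ∑ j ∈ N i, x j ^ 2 - 2 * pairing S N x x := by
    simp only [pairing, dirichlet, Finset.mul_sum, ← Finset.sum_add_distrib,
      ← Finset.sum_sub_distrib]
    exact Finset.sum_congr rfl fun i _ => Finset.sum_congr rfl fun j _ => by ring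
  linarith

lemma pairing_comm (h : IsNeighborhood S N) (x y : V → ℝ) :
    pairing S N x y = pairing S N y x := by
  rw [pairing, h.sum_swap]
  exact Finset.sum_congr rfl fun i _ => Finset.sum_congr rfl fun j _ => mul_comm _ _

lemma pairing_average (h : IsNeighborhood S N) (x : V → ℝ) :
    pairing S N x (average N x) = energy S N (average N x) := by
  refine Finset.sum_congr rfl fun i hi => ?_
  rw [← Finset.sum_mul, ← h.card_mul_average x hi]
  ring

/-! ### Spectral bounds and contraction -/

/-- The self-loops keep the averaging operator away from `-1`. -/
lemma neg_pairing_le (h : IsNeighborhood S N) {n : ℝ} (hn : ∀ i ∈ S, ((N i).card : ℝ) ≤ n)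
    (hn0 : 0 < n) (x : V → ℝ) :
    -pairing S N x x ≤ (1 - 2 / n) * energy S N x := by
  -- Only the self-loop terms j = i are kept, each equal to (2 x_i)².
  have h1 : ∑ i ∈ S, 4 * x i ^ 2 ≤ ∑ i ∈ S, ∑ j ∈ N i, (x i + x j) ^ 2 := by
    refine Finset.sum_le_sum fun i hi => ?_
    refine le_trans (le_of_eq (by ring))
      (Finset.single_le_sum (f := fun j => (x i + x j) ^ 2) (fun j _ => sq_nonneg _) (h.refl i hi))
  have h2 : 4 / n * energy S N x ≤ ∑ i ∈ S, 4 * x i ^ 2 := by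
    rw [energy, Finset.mul_sum]
    refine Finset.sum_le_sum fun i hi => ?_
    have : ((N i).card : ℝ) / n ≤ 1 := (div_le_one hn0).2 (hn i hi)
    calc 4 / n * (((N i).card : ℝ) * x i ^ 2) = ((N i).card : ℝ) / n * (4 * x i ^ 2) := by ring
      _ ≤ 1 * (4 * x i ^ 2) := by gcongr
      _ = _ := one_mul _
  have h3 := h.energy_add_pairing x
  have : 4 / n * energy S N x = 2 * (2 / n * energy S N x) := by ring
  linarith

/-- Poincaré inequality, from a bound of the oscillation by the Dirichlet form. -/
lemma energy_le_dirichlet (h : IsNeighborhood S N) {n : ℝ} (hn0 : 0 ≤ n)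
    (hn : ∀ i ∈ S, ((N i).card : ℝ) ≤ n) (hS : (S.card : ℝ) ≤ n)
    (hpath : ∀ x : V → ℝ, ∀ i ∈ S, ∀ j ∈ S, (x i - x j) ^ 2 ≤ n * dirichlet S N x)
    (x : V → ℝ) (hx : ∑ i ∈ S, ((N i).card : ℝ) * x i = 0) :
    energy S N x ≤ n ^ 3 * dirichlet S N x := by
  have hD : 0 ≤ dirichlet S N x :=
    Finset.sum_nonneg fun _ _ => Finset.sum_nonneg fun _ _ => sq_nonneg _
  -- Weighted mean zero yields some x_j of sign opposite to x_i, so |x_i| ≤ |x_i - x_j|.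
  have key : ∀ i ∈ S, x i ^ 2 ≤ n * dirichlet S N x := by
    intro i hi
    obtain hxi | hxi := le_total 0 (x i)
    · obtain ⟨j, hj, hxj⟩ : ∃ j ∈ S, x j ≤ 0 := by
        by_contra! hc
        exact (Finset.sum_pos (fun j hj => mul_pos (h.card_pos hj) (hc j hj)) ⟨i, hi⟩).ne' hx
      exact le_trans (by nlinarith) (hpath x i hi j hj)
    · obtain ⟨j, hj, hxj⟩ : ∃ j ∈ S, 0 ≤ x j := by
        by_contra! hc
        exact (Finset.sum_neg (fun j hj => mul_neg_of_pos_of_neg (h.card_pos hj) (hc j hj))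
          ⟨i, hi⟩).ne hx
      exact le_trans (by nlinarith) (hpath x i hi j hj)
  calc energy S N x ≤ ∑ i ∈ S, n * (n * dirichlet S N x) :=
        Finset.sum_le_sum fun i hi => mul_le_mul (hn i hi) (key i hi) (sq_nonneg _) hn0
    _ = S.card * (n * (n * dirichlet S N x)) := by simp
    _ ≤ n * (n * (n * dirichlet S N x)) := by gcongr
    _ = _ := by ring

/-- A self-adjoint operator whose quadratic form is bounded by `r` has norm at most `r`. -/
lemma energy_average_le (h : IsNeighborhood S N) {r : ℝ} (hr : 0 < r)
    (hform : ∀ x : V → ℝ, ∑ i ∈ S, ((N i).card : ℝ) * x i = 0 →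
      |pairing S N x x| ≤ r * energy S N x)
    (x : V → ℝ) (hx : ∑ i ∈ S, ((N i).card : ℝ) * x i = 0) :
    energy S N (average N x) ≤ r ^ 2 * energy S N x := by
  set y := average N x with hy
  have hy0 : ∑ i ∈ S, ((N i).card : ℝ) * y i = 0 := (h.sum_card_mul_average x).trans hx
  -- Polarization with the test vectors r x ± y: the pairings differ by 4r times the energy of y,
  -- and the energies add up by the parallelogram law.
  have hlin : ∀ t : ℝ, ∑ i ∈ S, ((N i).card : ℝ) * (r * x i + t * y i) = 0 := fun t => by
    have : ∑ i ∈ S, ((N i).card : ℝ) * (r * x i + t * y i) =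
        r * ∑ i ∈ S, ((N i).card : ℝ) * x i + t * ∑ i ∈ S, ((N i).card : ℝ) * y i := by
      simp only [Finset.mul_sum, ← Finset.sum_add_distrib]
      exact Finset.sum_congr rfl fun i _ => by ring
    rw [this, hx, hy0]; ring
  have hpair : ∀ t : ℝ, pairing S N (fun i => r * x i + t * y i) (fun i => r * x i + t * y i) =
      r ^ 2 * pairing S N x x + r * t * pairing S N x y + t * r * pairing S N y x
        + t ^ 2 * pairing S N y y := fun t => by
    simp only [pairing, Finset.mul_sum, ← Finset.sum_add_distrib]
    exact Finset.sum_congr rfl fun i _ => Finset.sum_congr rfl fun j _ => by ring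
  have hen : energy S N (fun i => r * x i + 1 * y i) + energy S N (fun i => r * x i + (-1) * y i) =
      2 * (r ^ 2 * energy S N x + energy S N y) := by
    simp only [energy, Finset.mul_sum, ← Finset.sum_add_distrib]
    exact Finset.sum_congr rfl fun i _ => by ring
  have h1 := (le_abs_self _).trans (hform _ (hlin 1))
  have h2 := (neg_le_abs _).trans (hform _ (hlin (-1)))
  rw [hpair] at h1 h2
  rw [h.pairing_comm y x, hy, h.pairing_average x, ← hy] at h1 h2
  have h3 : r * (4 * energy S N y) ≤ r * (2 * (r ^ 2 * energy S N x + energy S N y)) := by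
    rw [← hen]; linarith
  linarith [le_of_mul_le_mul_left h3 hr]

/-- Averaging over a connected neighbourhood structure contracts the centred energy. -/
lemma energy_average_le_of_oscillation (h : IsNeighborhood S N) {n : ℝ} (hn1 : 1 ≤ n)
    (hn : ∀ i ∈ S, ((N i).card : ℝ) ≤ n) (hS : (S.card : ℝ) ≤ n)
    (hpath : ∀ x : V → ℝ, ∀ i ∈ S, ∀ j ∈ S, (x i - x j) ^ 2 ≤ n * dirichlet S N x)
    (x : V → ℝ) (hx : ∑ i ∈ S, ((N i).card : ℝ) * x i = 0) :
    energy S N (average N x) ≤ (1 - 1 / (2 * n ^ 3)) ^ 2 * energy S N x := by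
  have hn0 : 0 < n := by linarith
  have hn3 : n ≤ n ^ 3 := le_self_pow₀ hn1 (by norm_num)
  have hlt : 1 / (2 * n ^ 3) < 1 := by rw [div_lt_one (by positivity)]; linarith
  refine h.energy_average_le (by linarith) (fun z hz => ?_) x hx
  have hE := energy_nonneg S N z
  refine abs_le'.2 ⟨?_, ?_⟩
  · have h1 := h.energy_le_dirichlet hn0.le hn hS hpath z hz
    have h2 := h.energy_sub_pairing z
    have h3 : 1 / (2 * n ^ 3) * energy S N z ≤ energy S N z - pairing S N z z := by
      rw [one_div, inv_mul_le_iff₀ (by positivity)]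
      exact h1.trans_eq (by rw [← h2]; ring)
    linarith
  · refine (h.neg_pairing_le hn hn0 z).trans (mul_le_mul_of_nonneg_right ?_ hE)
    have : 1 / (2 * n ^ 3) ≤ 2 / n := by
      rw [div_le_div_iff₀ (by positivity) hn0]; linarith
    linarith

lemma average_sub_const (h : IsNeighborhood S N) (x : V → ℝ) (c : ℝ) {i : V} (hi : i ∈ S) :
    average N (fun j => x j - c) i = average N x i - c := by
  rw [average, average, Finset.sum_sub_distrib, sub_div]
  simp [(h.card_pos hi).ne']

/-- Iterated averaging: the differences of opinions decay geometrically. -/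
lemma sq_sub_le_of_iterate (h : IsNeighborhood S N) {n : ℝ} (hn1 : 1 ≤ n)
    (hn : ∀ i ∈ S, ((N i).card : ℝ) ≤ n) (hS : (S.card : ℝ) ≤ n)
    (hpath : ∀ x : V → ℝ, ∀ i ∈ S, ∀ j ∈ S, (x i - x j) ^ 2 ≤ n * dirichlet S N x)
    {x : ℕ → V → ℝ} {T : ℕ} (hstep : ∀ k < T, ∀ i ∈ S, x (k + 1) i = average N (x k) i)
    {i j : V} (hi : i ∈ S) (hj : j ∈ S) (hij : i ≠ j) :
    (x T i - x T j) ^ 2 ≤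
      2 * (((1 - 1 / (2 * n ^ 3)) ^ 2) ^ T * (n ^ 3 * dirichlet S N (x 0))) := by
  have hn0 : 0 < n := by linarith
  set w : ℝ := ∑ i ∈ S, ((N i).card : ℝ) with hw
  have hw0 : 0 < w := Finset.sum_pos (fun i hi => h.card_pos hi) ⟨i, hi⟩
  set c : ℝ := (∑ i ∈ S, ((N i).card : ℝ) * x 0 i) / w with hc
  have hsub : ∀ z : V → ℝ, ∑ i ∈ S, ((N i).card : ℝ) * (z i - c) =
      ∑ i ∈ S, ((N i).card : ℝ) * z i - w * c := fun z => by
    simp only [mul_sub, Finset.sum_sub_distrib, ← Finset.sum_mul, hw]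
  have hnext : ∀ k < T, ∀ i ∈ S, x (k + 1) i - c = average N (fun j => x k j - c) i :=
    fun k hk i hi => by rw [h.average_sub_const _ _ hi, hstep k hk i hi]
  have key : ∀ k ≤ T, ∑ i ∈ S, ((N i).card : ℝ) * (x k i - c) = 0 ∧
      energy S N (fun i => x k i - c) ≤
        ((1 - 1 / (2 * n ^ 3)) ^ 2) ^ k * energy S N (fun i => x 0 i - c) := by
    intro k
    induction k with
    | zero =>
      refine fun _ => ⟨?_, by simp⟩
      rw [hsub, hc, mul_div_cancel₀ _ hw0.ne', sub_self]
    | succ k ih =>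
      intro hk
      obtain ⟨h1, h2⟩ := ih (by omega)
      have e : energy S N (fun i => x (k + 1) i - c) =
          energy S N (average N (fun j => x k j - c)) :=
        Finset.sum_congr rfl fun i hi => by beta_reduce; rw [hnext k (by omega) i hi]
      refine ⟨?_, ?_⟩
      · rw [Finset.sum_congr rfl fun i hi => by rw [hnext k (by omega) i hi],
          h.sum_card_mul_average, h1]
      · rw [e, pow_succ', mul_assoc]
        exact (h.energy_average_le_of_oscillation hn1 hn hS hpath _ h1).trans
          (mul_le_mul_of_nonneg_left h2 (sq_nonneg _))
  have h0 : energy S N (fun i => x 0 i - c) ≤ n ^ 3 * dirichlet S N (x 0) := by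
    refine (h.energy_le_dirichlet hn0.le hn hS hpath _ (key 0 (Nat.zero_le _)).1).trans_eq ?_
    simp [dirichlet]
  have hT := (key T le_rfl).2.trans (mul_le_mul_of_nonneg_left h0 (by positivity))
  -- The factor 2 in the claim comes from (a - b)² ≤ 2(a² + b²).
  have hle : (x T i - c) ^ 2 + (x T j - c) ^ 2 ≤ energy S N (fun i => x T i - c) := by
    classical
    calc (x T i - c) ^ 2 + (x T j - c) ^ 2 = ∑ l ∈ {i, j}, (x T l - c) ^ 2 :=
          (Finset.sum_pair (f := fun l => (x T l - c) ^ 2) hij).symm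
      _ ≤ ∑ l ∈ S, (x T l - c) ^ 2 :=
          Finset.sum_le_sum_of_subset_of_nonneg (by simp [Finset.insert_subset_iff, hi, hj])
            fun _ _ _ => sq_nonneg _
      _ ≤ _ := Finset.sum_le_sum fun l hl =>
          le_mul_of_one_le_left (sq_nonneg _) (h.one_le_card hl)
  nlinarith [sq_nonneg ((x T i - c) + (x T j - c))]

end IsNeighborhood

/-! ### Oscillation along paths -/

/-- Along a path of a graph, the oscillation is controlled by the Dirichlet form. -/
lemma sq_sub_le_dirichlet [Fintype V] {H : SimpleGraph V} (x : V → ℝ)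
    (hadj : ∀ i j, H.Adj i j → j ∈ N i) (hclosed : ∀ i j, H.Adj i j → i ∈ S → j ∈ S)
    {u v : V} (hu : u ∈ S) (huv : H.Reachable u v) :
    (x u - x v) ^ 2 ≤ (Fintype.card V : ℝ) * dirichlet S N x := by
  classical
  obtain ⟨p, hp⟩ := huv.exists_isPath
  have hmem : ∀ t, t ≤ p.length → p.getVert t ∈ S := by
    intro t
    induction t with
    | zero => simpa using hu
    | succ t ih => exact fun ht => hclosed _ _ (p.adj_getVert_succ (by omega)) (ih (by omega))
  have hD : ∑ t ∈ range p.length, (x (p.getVert t) - x (p.getVert (t + 1))) ^ 2 ≤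
      dirichlet S N x := by
    rw [dirichlet, Finset.sum_sigma']
    -- A path repeats no vertex, so its edges are distinct terms of the Dirichlet sum.
    have hinj : Set.InjOn (fun t => (⟨p.getVert t, p.getVert (t + 1)⟩ : (_ : V) × V))
        (range p.length : Finset ℕ) := by
      intro a ha b hb hab
      simp only [coe_range, Set.mem_Iio] at ha hb
      exact hp.getVert_injOn (by simpa using ha.le) (by simpa using hb.le) (congrArg Sigma.fst hab)
    rw [← Finset.sum_image (f := fun q : (_ : V) × V => (x q.1 - x q.2) ^ 2) hinj]
    refine Finset.sum_le_sum_of_subset_of_nonneg ?_ fun _ _ _ => sq_nonneg _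
    intro q hq
    obtain ⟨t, ht, rfl⟩ := Finset.mem_image.1 hq
    rw [Finset.mem_range] at ht
    exact Finset.mem_sigma.2 ⟨hmem t ht.le, hadj _ _ (p.adj_getVert_succ ht)⟩
  have htel : ∑ t ∈ range p.length, (x (p.getVert t) - x (p.getVert (t + 1))) = x u - x v := by
    rw [Finset.sum_range_sub' fun t => x (p.getVert t)]
    simp
  have hcs := sq_sum_le_card_mul_sum_sq (s := range p.length)
    (f := fun t => x (p.getVert t) - x (p.getVert (t + 1)))
  rw [htel, Finset.card_range] at hcs
  refine hcs.trans (mul_le_mul ?_ hD (Finset.sum_nonneg fun _ _ => sq_nonneg _) (by positivity))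
  exact_mod_cast hp.length_lt.le

end Averaging

/-- By 1 - u ≤ exp(-u) the power is at most exp(-T/n³); absorbing 2 ≤ n into n⁶ gives n⁷, hence the
constant 7. -/
lemma le_log_of_pow_ge {n : ℝ} (hn : 2 ≤ n) {T : ℕ}
    (h : 1 ≤ 2 * (((1 - 1 / (2 * n ^ 3)) ^ 2) ^ T * n ^ 6)) :
    (T : ℝ) ≤ 7 * (n ^ 3 * Real.log n) := by
  have hn0 : 0 < n := by linarith
  have hn3 : 0 < n ^ 3 := by positivity
  have h1 : ((1 - 1 / (2 * n ^ 3)) ^ 2) ^ T ≤ Real.exp (-(T / n ^ 3)) := by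
    have hlt : 1 / (2 * n ^ 3) ≤ 1 := by
      rw [div_le_one (by positivity)]
      linarith [le_self_pow₀ (by linarith : 1 ≤ n) (by norm_num : (3 : ℕ) ≠ 0)]
    rw [← pow_mul]
    calc (1 - 1 / (2 * n ^ 3)) ^ (2 * T) ≤ Real.exp (-(1 / (2 * n ^ 3))) ^ (2 * T) :=
          pow_le_pow_left₀ (by linarith) (Real.one_sub_le_exp_neg _) _
      _ = Real.exp (-(T / n ^ 3)) := by
          rw [← Real.exp_nat_mul]
          congr 1
          push_cast
          field_simp
  have h2 : (1 : ℝ) ≤ Real.exp (-(T / n ^ 3)) * n ^ 7 := by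
    calc (1 : ℝ) ≤ 2 * (((1 - 1 / (2 * n ^ 3)) ^ 2) ^ T * n ^ 6) := h
      _ ≤ n * (Real.exp (-(T / n ^ 3)) * n ^ 6) := by gcongr
      _ = _ := by ring
  have h3 := Real.log_nonneg h2
  rw [Real.log_mul (Real.exp_ne_zero _) (by positivity), Real.log_exp, Real.log_pow] at h3
  push_cast at h3
  have h4 : T / n ^ 3 ≤ 7 * Real.log n := by linarith
  rw [div_le_iff₀ hn3] at h4
  linarith

/-! ### The frozen influence graph -/

lemma mem_neighbors {n : ℕ} {G : SimpleGraph (Fin n)} {R : ℝ} {x : Fin n → ℝ} {i j : Fin n} :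
    j ∈ neighbors G R x i ↔ j = i ∨ (influenceGraph G R x).Adj i j := by
  simp [neighbors]

/-- Without breaks and formations, the links of the agents of a component stay the same. -/
lemma adj_iff_of_no_change {n : ℕ} {G : SimpleGraph (Fin n)} {R : ℝ} {x0 : Fin n → ℝ}
    {k₀ k₁ : ℕ} {P : (influenceGraphAt G R x0 k₀).ConnectedComponent}
    (hbreak : ∀ k : ℕ, k₀ < k → k < k₁ → ∀ i ∈ P.supp, ∀ j ∈ P.supp, ¬ LinkBreak G R x0 k i j)
    (hform : ∀ k : ℕ, k₀ < k → k < k₁ → ∀ i ∈ P.supp, ∀ j : Fin n, ¬ LinkFormation G R x0 k i j)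
    {t : ℕ} (ht : k₀ + t < k₁) {i : Fin n} (hi : i ∈ P.supp) (j : Fin n) :
    (influenceGraphAt G R x0 (k₀ + t)).Adj i j ↔ (influenceGraphAt G R x0 k₀).Adj i j := by
  induction t with
  | zero => rfl
  | succ t ih =>
    have ih := ih (by omega)
    have hsucc : k₀ + (t + 1) - 1 = k₀ + t := by omega
    constructor
    · intro h
      by_contra hc
      exact hform (k₀ + (t + 1)) (by omega) ht i hi j
        ⟨by omega, by rwa [hsucc, ih], h⟩
    · intro h
      by_contra hc
      -- A link of time k₀ stays inside the component, so excluding internal breaks suffices.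
      have hj : j ∈ P.supp := (P.mem_supp_congr_adj h).1 hi
      exact hbreak (k₀ + (t + 1)) (by omega) ht i hi j hj
        ⟨by omega, by rwa [hsucc, ih], hc⟩

end SocialHK

/-! ### Conclusion -/

open SocialHK in
theorem mainTheorem8 :
    ∃ C : ℝ, 0 < C ∧
      ∀ (n : ℕ) (G : SimpleGraph (Fin n)) (R : ℝ), 0 < R →
      ∀ (x0 : Fin n → ℝ) (k₀ k₁ : ℕ), k₀ < k₁ →
      ∀ P : (SocialHK.influenceGraphAt G R x0 k₀).ConnectedComponent,
        (∀ k : ℕ, k₀ < k → k < k₁ → ∀ i ∈ P.supp, ∀ j ∈ P.supp,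
          ¬ SocialHK.LinkBreak G R x0 k i j) →
        (∃ i ∈ P.supp, ∃ j ∈ P.supp, SocialHK.LinkBreak G R x0 k₁ i j) →
        (∀ k : ℕ, k₀ < k → k < k₁ → ∀ i ∈ P.supp, ∀ j : Fin n,
          ¬ SocialHK.LinkFormation G R x0 k i j) →
        ((k₁ : ℝ) - (k₀ : ℝ)) ≤ C * ((n : ℝ) ^ 3 * Real.log (n : ℝ)) := by
  classical
  refine ⟨7, by norm_num, ?_⟩
  rintro n G R hR x0 k₀ k₁ hk P hbreak ⟨i, hi, j, hj, -, hadj, hnadj⟩ hform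
  obtain ⟨T, rfl⟩ := Nat.exists_eq_add_of_lt hk
  have hij : i ≠ j := hadj.ne
  have hn2 : (2 : ℝ) ≤ n := by
    have : 1 < Fintype.card (Fin n) := Fintype.one_lt_card_iff.2 ⟨i, j, hij⟩
    rw [Fintype.card_fin] at this
    exact_mod_cast this
  set S : Finset (Fin n) := P.supp.toFinset with hS
  have hmem : ∀ {l}, l ∈ S ↔ l ∈ P.supp := by simp [hS]
  set N := neighbors G R (state G R x0 k₀) with hN
  have hclosed : ∀ a b, (influenceGraphAt G R x0 k₀).Adj a b → a ∈ S → b ∈ S := fun a b h ha =>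
    hmem.2 ((P.mem_supp_congr_adj h).1 (hmem.1 ha))
  have hNb : IsNeighborhood S N :=
    { refl := fun a _ => mem_neighbors.2 (Or.inl rfl)
      symm := fun a _ b _ h => mem_neighbors.2
        ((mem_neighbors.1 h).imp Eq.symm SimpleGraph.Adj.symm)
      closed := fun a ha b hb => by
        obtain rfl | h := mem_neighbors.1 hb
        · exact ha
        · exact hclosed a b h ha }
  have hcard : ∀ s : Finset (Fin n), (s.card : ℝ) ≤ n := fun s => by
    exact_mod_cast s.card_le_univ.trans_eq (Fintype.card_fin n)
  have hpath : ∀ x : Fin n → ℝ, ∀ a ∈ S, ∀ b ∈ S, (x a - x b) ^ 2 ≤ n * dirichlet S N x := by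
    intro x a ha b hb
    have := sq_sub_le_dirichlet (S := S) (N := N) (H := influenceGraphAt G R x0 k₀) x
      (fun _ _ h => mem_neighbors.2 (Or.inr h)) hclosed ha
      (P.reachable_of_mem_supp (hmem.1 ha) (hmem.1 hb))
    rwa [Fintype.card_fin] at this
  -- Here k₁ = k₀ + T + 1. The last step is included: it uses the graph at time k₁ - 1, which is
  -- still unchanged.
  have hstep : ∀ k < T + 1, ∀ a ∈ S, state G R x0 (k₀ + (k + 1)) a =
      average N (state G R x0 (k₀ + k)) a := by
    intro k hk a ha
    have hNa : neighbors G R (state G R x0 (k₀ + k)) a = N a := by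
      ext b
      rw [hN, mem_neighbors, mem_neighbors]
      exact or_congr Iff.rfl
        (adj_iff_of_no_change hbreak hform (by omega) (hmem.1 ha) b)
    change step G R (state G R x0 (k₀ + k)) a = _
    rw [step, average, hNa]
  have hfin := hNb.sq_sub_le_of_iterate (n := n) (by linarith) (fun a _ => hcard _) (hcard _) hpath
    (x := fun k => state G R x0 (k₀ + k)) hstep (hmem.2 hi) (hmem.2 hj) hij
  have hdir : dirichlet S N (state G R x0 k₀) ≤ n ^ 3 * R ^ 2 := by
    calc dirichlet S N (state G R x0 k₀) ≤ ∑ a ∈ S, ∑ b ∈ N a, R ^ 2 := by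
          refine Finset.sum_le_sum fun a _ => Finset.sum_le_sum fun b hb => ?_
          rw [← sq_abs (_ - _)]
          refine pow_le_pow_left₀ (abs_nonneg _) ?_ 2
          obtain rfl | h := mem_neighbors.1 hb
          · simpa using hR.le
          · exact h.2
      _ ≤ ∑ a ∈ S, n * R ^ 2 := Finset.sum_le_sum fun a _ => by
          rw [Finset.sum_const, nsmul_eq_mul]
          exact mul_le_mul_of_nonneg_right (hcard _) (sq_nonneg R)
      _ = S.card * (n * R ^ 2) := by rw [Finset.sum_const, nsmul_eq_mul]
      _ ≤ n * (n * R ^ 2) := mul_le_mul_of_nonneg_right (hcard _) (by positivity)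
      _ = n ^ 2 * R ^ 2 := by ring
      _ ≤ n ^ 3 * R ^ 2 := by gcongr <;> linarith
  -- The physical link persists, so only the confidence bound can fail.
  have hgt : R < |state G R x0 (k₀ + (T + 1)) i - state G R x0 (k₀ + (T + 1)) j| := by
    by_contra! hc
    exact hnadj ⟨hadj.1, hc⟩
  have hsq : R ^ 2 < (state G R x0 (k₀ + (T + 1)) i - state G R x0 (k₀ + (T + 1)) j) ^ 2 := by
    rw [← sq_abs (_ - _)]
    gcongr
  have hfin' : 1 * R ^ 2 ≤ 2 * (((1 - 1 / (2 * (n : ℝ) ^ 3)) ^ 2) ^ (T + 1) * n ^ 6) * R ^ 2 := by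
    calc 1 * R ^ 2 ≤ _ := (one_mul (R ^ 2)).trans_le hsq.le
      _ ≤ _ := hfin
      _ ≤ 2 * (((1 - 1 / (2 * (n : ℝ) ^ 3)) ^ 2) ^ (T + 1) * (n ^ 3 * (n ^ 3 * R ^ 2))) := by
          gcongr
          exact hdir
      _ = _ := by ring
  have hT := le_log_of_pow_ge hn2 (le_of_mul_le_mul_right hfin' (by positivity))
  push_cast at hT ⊢
  linarith
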